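/- Let $X$ be a real Banach space and $n\ge 2$ an integer. For $x_1,\dots,x_n\in X$, not all zero, put $$C^{(n)}(x_1,\dots,x_n)=\frac{\sum_{\theta_2,\dots,\theta_n\in\{-1,1\}}\bigl\|x_1+\sum_{j=2}^n\theta_jx_j\bigr\|_X^2}{2^{n-1}\sum_{j=1}^n\|x_j\|_X^2}.$$ The lower $n$-th von Neumann–Jordan constant $\underline{C}_{NJ}^{(n)}(X)$ is the largest constant $C>0$ such that $C\le C^{(n)}(x_1,\dots,x_n)$ for all $x_1,\dots,x_n\in X$ that are not all zero. Let $n\ge 2$ and $2\le p\le\infty$, and let $X$ be either the real space $L^p(\mu)$ of an arbitrary measure space $(\Omega,\Sigma,\mu)$ or the real sequence space $l^p(I)$ over an arbitrary index set $I$ (for example $I=\{1,\dots,k\}$ or $I=\mathbb{N}$). If $\dim X\ge n$, then $$\underline{C}_{NJ}^{(n)}(X)=n^{\frac{2}{p}-1},$$ where $2/p=0$ if $p=\infty$. -/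

import Mathlib

open scoped ENNReal

/-- The quotient `C⁽ⁿ⁾(x₁, …, xₙ)`, with `xⱼ` written as `x (j - 1)`. The sum runs over all families
of signs `θ` whose first sign is `1`, so that `∑ j, θ j • x j` is `x₁ + ∑_{j ≥ 2} θⱼ xⱼ`. -/
noncomputable def njQuotient {X : Type*} [NormedAddCommGroup X] {n : ℕ} (x : Fin n → X) : ℝ :=
  (∑ θ : Fin n → ℤˣ with ∀ j : Fin n, (j : ℕ) = 0 → θ j = 1, ‖∑ j, (θ j : ℤ) • x j‖ ^ 2) /
    (2 ^ (n - 1) * ∑ j, ‖x j‖ ^ 2)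

/-- The constants `C > 0` with `C ≤ C⁽ⁿ⁾(x₁, …, xₙ)` for all `x₁, …, xₙ ∈ X` that are not all
zero. -/
def lowerNJBounds (n : ℕ) (X : Type*) [NormedAddCommGroup X] : Set ℝ :=
  {C : ℝ | 0 < C ∧ ∀ x : Fin n → X, 0 < ∑ j, ‖x j‖ ^ 2 → C ≤ njQuotient x}

/-- The lower `n`-th von Neumann–Jordan constant of `X`: the largest constant `C > 0` with
`C ≤ C⁽ⁿ⁾(x₁, …, xₙ)` for all `x₁, …, xₙ ∈ X` that are not all zero. -/
noncomputable def lowerNJConstant (n : ℕ) (X : Type*) [NormedAddCommGroup X] : ℝ :=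
  sSup (lowerNJBounds n X)

/-! Averaging `(∑ θⱼ xⱼ)²` over the signs gives `∑ xⱼ²` pointwise. As `p / 2 ≥ 1`, the triangle
inequality in `L^(p/2)` bounds the mean of `‖∑ θⱼ xⱼ‖²` below by the `L^(p/2)` norm of `∑ xⱼ²`,
which is at least `n^(2/p - 1) ∑ ‖xⱼ‖²` (`sum_eLpNorm_le_of_nonneg`). This is the lower bound.

It is attained by disjointly supported unit vectors: every signed sum then has norm at most
`n^(1/p)`. Such vectors exist in dimension at least `n`, by
`exists_disjoint_sets_of_linearIndependent`. The sequence spaces are `L^p` of counting measure. -/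

/-! ### Orthogonality of signs -/

/-- Flipping `θ j` negates the summand. The sign at index `0` is frozen, so the flipped index must
be the nonzero one of the two. -/
theorem sum_signs_mul_eq_zero {n : ℕ} {i j : Fin n} (hij : i ≠ j) :
    ∑ θ : Fin n → ℤˣ with ∀ k : Fin n, (k : ℕ) = 0 → θ k = 1, (((θ i : ℤ) : ℝ) * ((θ j : ℤ) : ℝ))
      = 0 := by
  wlog hj : (j : ℕ) ≠ 0 generalizing i j
  · have hi : (i : ℕ) ≠ 0 := fun h => hij (Fin.ext (by omega))
    simpa only [mul_comm] using this hij.symm hi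
  refine Finset.sum_involution (fun θ _ => Function.update θ j (-θ j)) ?_ ?_ ?_ ?_
  · intro θ _
    simp [Function.update_of_ne hij]
  · intro θ _ _ h
    have h1 := congrFun h j
    rw [Function.update_self] at h1
    exact units_ne_neg_self (θ j) h1.symm
  · intro θ hθ
    simp only [Finset.mem_filter, Finset.mem_univ, true_and] at hθ ⊢
    intro k hk
    rw [Function.update_of_ne (by rintro rfl; exact hj hk)]
    exact hθ k hk
  · intro θ _
    simp

theorem card_signs {n : ℕ} (hn : 0 < n) :
    (Finset.univ.filter fun θ : Fin n → ℤˣ => ∀ k : Fin n, (k : ℕ) = 0 → θ k = 1).card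
      = 2 ^ (n - 1) := by
  obtain ⟨m, rfl⟩ := Nat.exists_eq_succ_of_ne_zero hn.ne'
  have h : (Finset.univ.filter fun θ : Fin (m + 1) → ℤˣ => ∀ k : Fin (m + 1), (k : ℕ) = 0 → θ k = 1)
      = Fintype.piFinset fun k => if k = 0 then {1} else Finset.univ := by
    ext θ
    simp only [Finset.mem_filter, Finset.mem_univ, true_and, Fintype.mem_piFinset]
    refine forall_congr' fun k => ?_
    by_cases hk : k = 0 <;> simp [hk, Int.units_eq_one_or]
  rw [h, Fintype.card_piFinset, Fin.prod_univ_succ]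
  simp [Fin.succ_ne_zero]

theorem sum_signs_sq {n : ℕ} (hn : 0 < n) (a : Fin n → ℝ) :
    ∑ θ : Fin n → ℤˣ with ∀ k : Fin n, (k : ℕ) = 0 → θ k = 1, (∑ j, (θ j : ℤ) • a j) ^ 2
      = 2 ^ (n - 1) * ∑ j, a j ^ 2 := by
  have key : ∀ i j : Fin n,
      ∑ θ : Fin n → ℤˣ with ∀ k : Fin n, (k : ℕ) = 0 → θ k = 1,
        (((θ i : ℤ) : ℝ) * ((θ j : ℤ) : ℝ)) = if i = j then 2 ^ (n - 1) else 0 := by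
    intro i j
    split_ifs with h
    · subst h
      have : ∀ θ : Fin n → ℤˣ, (((θ i : ℤ) : ℝ) * ((θ i : ℤ) : ℝ)) = 1 := by
        intro θ
        rcases Int.units_eq_one_or (θ i) with h | h <;> simp [h]
      simp only [this, Finset.sum_const, card_signs hn]
      simp
    · exact sum_signs_mul_eq_zero h
  simp only [zsmul_eq_mul, pow_two, Finset.sum_mul_sum]
  rw [Finset.sum_comm, Finset.mul_sum]
  refine Finset.sum_congr rfl fun i _ => ?_
  rw [Finset.sum_comm]
  have : ∀ j, ∑ θ : Fin n → ℤˣ with ∀ k : Fin n, (k : ℕ) = 0 → θ k = 1,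
      ((θ i : ℤ) : ℝ) * a i * (((θ j : ℤ) : ℝ) * a j)
      = (if i = j then 2 ^ (n - 1) else 0) * (a i * a j) := by
    intro j
    rw [← key, Finset.sum_mul]
    exact Finset.sum_congr rfl fun θ _ => by ring
  simp [this]

/-! ### Norm estimates for nonnegative and for disjoint functions -/

open MeasureTheory

theorem ENNReal.sum_rpow_le_rpow_sum {ι : Type*} (s : Finset ι) (f : ι → ℝ≥0∞) {q : ℝ}
    (hq : 1 ≤ q) : ∑ i ∈ s, f i ^ q ≤ (∑ i ∈ s, f i) ^ q := by
  classical
  induction s using Finset.induction_on with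
  | empty => simp
  | insert a s ha ih =>
    rw [Finset.sum_insert ha, Finset.sum_insert ha]
    exact (add_le_add_right ih _).trans (ENNReal.add_rpow_le_rpow_add _ _ hq)

theorem rpow_eLpNorm_eq_lintegral {Ω E : Type*} [MeasurableSpace Ω] [NormedAddCommGroup E]
    {μ : Measure Ω} {p : ℝ≥0∞} (hp : p ≠ 0) (hp' : p ≠ ∞) (f : Ω → E) :
    eLpNorm f p μ ^ p.toReal = ∫⁻ ω, ‖f ω‖ₑ ^ p.toReal ∂μ := by
  rw [eLpNorm_eq_lintegral_rpow_enorm_toReal hp hp', ← ENNReal.rpow_mul, one_div,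
    inv_mul_cancel₀ (ENNReal.toReal_pos hp hp').ne', ENNReal.rpow_one]

/-- For finite `q`, the power mean inequality gives the factor `n^(q - 1)` after raising to the
power `q`, and superadditivity of `t ↦ t^q` is then integrated. For `q = ∞` the convention `1 / 0 =
0` makes the factor `n`. -/
theorem sum_eLpNorm_le_of_nonneg {Ω : Type*} [MeasurableSpace Ω] {μ : Measure Ω} {n : ℕ}
    {q : ℝ≥0∞} (hq : 1 ≤ q) {b : Fin n → Ω → ℝ} (hb : ∀ j ω, 0 ≤ b j ω)
    (hm : ∀ j, Measurable (b j)) :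
    ∑ j, eLpNorm (b j) q μ ≤ (n : ℝ≥0∞) ^ (1 - 1 / q.toReal) * eLpNorm (∑ j, b j) q μ := by
  rcases eq_or_ne q ∞ with rfl | hq'
  · have : ∀ j ∈ Finset.univ, eLpNorm (b j) ∞ μ ≤ eLpNorm (∑ j, b j) ∞ μ := by
      intro j _
      refine eLpNorm_mono fun ω => ?_
      rw [Finset.sum_apply, Real.norm_of_nonneg (hb j ω),
        Real.norm_of_nonneg (Finset.sum_nonneg fun i _ => hb i ω)]
      exact Finset.single_le_sum (f := fun i => b i ω) (fun i _ => hb i ω) (Finset.mem_univ j)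
    simpa using Finset.sum_le_card_nsmul _ _ _ this
  · have hq0 : q ≠ 0 := (zero_lt_one.trans_le hq).ne'
    have hr : 1 ≤ q.toReal := by
      simpa using ENNReal.toReal_mono hq' hq
    have hr0 : 0 < q.toReal := by linarith
    rw [← ENNReal.rpow_le_rpow_iff hr0, ENNReal.mul_rpow_of_nonneg _ _ hr0.le, ← ENNReal.rpow_mul,
      show (1 - 1 / q.toReal) * q.toReal = q.toReal - 1 by field_simp,
      rpow_eLpNorm_eq_lintegral hq0 hq']
    refine (ENNReal.rpow_sum_le_const_mul_sum_rpow _ _ hr).trans ?_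
    rw [Finset.card_univ, Fintype.card_fin]
    gcongr
    simp only [rpow_eLpNorm_eq_lintegral hq0 hq']
    rw [← lintegral_finsetSum]
    · refine lintegral_mono fun ω => (ENNReal.sum_rpow_le_rpow_sum _ _ hr).trans_eq ?_
      congr 1
      rw [Finset.sum_apply, ← ofReal_norm, Real.norm_of_nonneg (Finset.sum_nonneg fun i _ => hb i ω),
        ENNReal.ofReal_sum_of_nonneg fun i _ => hb i ω]
      exact Finset.sum_congr rfl fun j _ => by rw [← ofReal_norm, Real.norm_of_nonneg (hb j ω)]
    · intro j _
      exact (hm j).enorm.pow_const _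

theorem eLpNorm_sum_le_of_disjoint {Ω : Type*} [MeasurableSpace Ω] {μ : Measure Ω} {n : ℕ}
    {p : ℝ≥0∞} (hp : 1 ≤ p) {f : Fin n → Ω → ℝ} (hm : ∀ j, Measurable (f j))
    (hd : ∀ ω i j, i ≠ j → f i ω = 0 ∨ f j ω = 0) (h1 : ∀ j, eLpNorm (f j) p μ ≤ 1) :
    eLpNorm (∑ j, f j) p μ ≤ (n : ℝ≥0∞) ^ (1 / p.toReal) := by
  have hpt : ∀ ω, (∑ j, f j) ω = 0 ∨ ∃ i, (∑ j, f j) ω = f i ω := by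
    intro ω
    by_cases h : ∃ i, f i ω ≠ 0
    · obtain ⟨i, hi⟩ := h
      have h0 : ∀ j ≠ i, f j ω = 0 := fun j hj => (hd ω j i hj).resolve_right hi
      refine Or.inr ⟨i, ?_⟩
      rw [Finset.sum_apply]
      exact Finset.sum_eq_single i (fun j _ hj => h0 j hj) (by simp)
    · push Not at h
      exact Or.inl (by simp [h])
  rcases eq_or_ne p ∞ with rfl | hp'
  · simp only [ENNReal.toReal_top, div_zero, ENNReal.rpow_zero]
    simp only [eLpNorm_exponent_top] at h1 ⊢
    refine essSup_le_of_ae_le _ ?_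
    have h2 : ∀ᵐ ω ∂μ, ∀ j, ‖f j ω‖ₑ ≤ 1 := ae_all_iff.2 fun j => by
      filter_upwards [enorm_ae_le_eLpNormEssSup (f j) μ] with ω hω using hω.trans (h1 j)
    filter_upwards [h2] with ω hω
    rcases hpt ω with h | ⟨i, h⟩
    · simp [h]
    · rw [h]; exact hω i
  · have hp0 : p ≠ 0 := (zero_lt_one.trans_le hp).ne'
    have hr0 : 0 < p.toReal := ENNReal.toReal_pos hp0 hp'
    rw [← ENNReal.rpow_le_rpow_iff hr0, ← ENNReal.rpow_mul, one_div, inv_mul_cancel₀ hr0.ne',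
      ENNReal.rpow_one, rpow_eLpNorm_eq_lintegral hp0 hp']
    calc ∫⁻ ω, ‖(∑ j, f j) ω‖ₑ ^ p.toReal ∂μ ≤ ∫⁻ ω, ∑ j, ‖f j ω‖ₑ ^ p.toReal ∂μ := by
          refine lintegral_mono fun ω => ?_
          rcases hpt ω with h | ⟨i, h⟩
          · simp [h, hr0]
          · rw [h]
            exact Finset.single_le_sum (f := fun j => ‖f j ω‖ₑ ^ p.toReal) (fun _ _ => zero_le)
              (Finset.mem_univ i)
      _ = ∑ j, eLpNorm (f j) p μ ^ p.toReal := by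
          rw [lintegral_finsetSum _ fun j _ => (hm j).enorm.pow_const _]
          simp only [rpow_eLpNorm_eq_lintegral hp0 hp']
      _ ≤ ∑ _j : Fin n, 1 := Finset.sum_le_sum fun j _ => ENNReal.rpow_le_one (h1 j) hr0.le
      _ = n := by simp

/-! ### Disjoint sets of positive measure from linear independence -/

/-- Push `μ` forward to `ℝⁿ` by `F = (v₁, …, vₙ)`. The nonzero points of its support span `ℝⁿ`,
since a functional killing them would be a linear relation among the `vⱼ`. So there are `n` such
points, and preimages of small neighbourhoods serve. -/
theorem exists_disjoint_sets_of_linearIndependent {Ω : Type*} [MeasurableSpace Ω] {μ : Measure Ω}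
    {n : ℕ} {p : ℝ≥0∞} {v : Fin n → Lp ℝ p μ} (hv : LinearIndependent ℝ v) :
    ∃ A : Fin n → Set Ω, (∀ i, MeasurableSet (A i)) ∧ (∀ i, μ (A i) ≠ 0) ∧
      Pairwise (Function.onFun Disjoint A) ∧ ∀ i, ∀ ω ∈ A i, (fun j => v j ω) ≠ 0 := by
  set F : Ω → Fin n → ℝ := fun ω j => v j ω with hF
  have hFm : Measurable F := measurable_pi_lambda _ fun j => (Lp.stronglyMeasurable (v j)).measurable
  set S : Set (Fin n → ℝ) := (μ.map F).support \ {0} with hS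
  have hspan : Submodule.span ℝ S = ⊤ := by
    by_contra hne
    obtain ⟨l, hl0, hl⟩ := Submodule.exists_le_ker_of_lt_top _ (lt_top_iff_ne_top.2 hne)
    have hae : ∀ᵐ ω ∂μ, l (F ω) = 0 := by
      have h1 : ∀ᵐ y ∂(μ.map F), l y = 0 := by
        filter_upwards [(Measure.support_mem_ae : (μ.map F).support ∈ ae (μ.map F))] with y hy
        rcases eq_or_ne y 0 with rfl | h0
        · simp
        · exact hl (Submodule.subset_span ⟨hy, h0⟩)
      exact ae_of_ae_map hFm.aemeasurable h1
    have hsum : ∑ j, l (Pi.single j 1) • v j = 0 := by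
      refine Lp.ext ?_
      have h2 : ∀ᵐ ω ∂μ, ∀ j, (l (Pi.single j 1) • v j : Lp ℝ p μ) ω = l (Pi.single j 1) * v j ω :=
        ae_all_iff.2 fun j => by
          filter_upwards [Lp.coeFn_smul (l (Pi.single j 1)) (v j)] with ω hω
          simpa using hω
      filter_upwards [Lp.coeFn_finsetSum Finset.univ fun j => l (Pi.single j 1) • v j, h2, hae,
        Lp.coeFn_zero ℝ p μ] with ω h3 h2 h4 h5
      rw [h3, h5, Finset.sum_apply, Pi.zero_apply, ← h4, LinearMap.pi_apply_eq_sum_univ l (F ω)]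
      refine Finset.sum_congr rfl fun j _ => ?_
      rw [h2, smul_eq_mul, mul_comm]
      congr 2
      ext k
      simp [Pi.single_apply, eq_comm]
    have hz := Fintype.linearIndependent_iff.1 hv _ hsum
    refine hl0 (LinearMap.pi_ext' fun j => LinearMap.ext_ring ?_)
    simpa using hz j
  obtain ⟨w, hwinj, hw⟩ : ∃ w : Fin n → Fin n → ℝ, Function.Injective w ∧ ∀ i, w i ∈ S := by
    have hcard : (n : ℕ∞) ≤ S.encard := by
      by_contra! hlt
      have hfin : S.Finite := Set.encard_lt_top_iff.1 (hlt.trans (ENat.natCast_lt_top n))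
      have : Fintype S := hfin.fintype
      have h1 := finrank_span_le_card (R := ℝ) S
      rw [hspan, finrank_top, Module.finrank_fin_fun] at h1
      rw [Set.encard_eq_coe_toFinset_card] at hlt
      exact absurd (Nat.cast_lt.1 hlt) (not_lt.2 h1)
    obtain ⟨T, hTS, hT⟩ := Set.exists_subset_encard_eq hcard
    have hTfin : T.Finite := Set.finite_of_encard_eq_coe hT
    have : Fintype T := hTfin.fintype
    have hc : Fintype.card T = n := by
      rw [Set.encard_eq_coe_toFinset_card, Set.toFinset_card] at hT
      exact_mod_cast hT
    let e := (Fintype.equivFinOfCardEq hc).symm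
    exact ⟨fun i => e i, Subtype.val_injective.comp e.injective, fun i => hTS (e i).2⟩
  -- Separating the points from `0` as well keeps `F` nonzero on the preimages.
  obtain ⟨U, hU, hUd⟩ := (((Set.finite_range w).insert 0)).t2_separation
  have hwm : ∀ i, w i ∈ insert 0 (Set.range w) := fun i => Or.inr ⟨i, rfl⟩
  refine ⟨fun i => F ⁻¹' U (w i), fun i => hFm (hU _).2.measurableSet, fun i => ?_, ?_, ?_⟩
  · have := (Measure.mem_support_iff_forall (w i)).1 (hw i).1 _ ((hU (w i)).2.mem_nhds (hU _).1)
    rw [Measure.map_apply hFm (hU _).2.measurableSet] at this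
    exact this.ne'
  · intro i j hij
    exact (hUd (hwm i) (hwm j) (hwinj.ne hij)).preimage F
  · intro i ω hω h0
    have h0' : F ω = 0 := h0
    have hd := hUd (hwm i) (Or.inl rfl) (hw i).2
    exact Set.disjoint_left.1 hd hω (h0' ▸ (hU 0).1 : F ω ∈ U 0)

/-! ### The constant of `L^p` -/

theorem Lp.coeFn_sum_zsmul {Ω : Type*} [MeasurableSpace Ω] {μ : Measure Ω} {p : ℝ≥0∞} {n : ℕ}
    (x : Fin n → Lp ℝ p μ) (c : Fin n → ℤ) :
    (∑ j, c j • x j : Lp ℝ p μ) =ᵐ[μ] fun ω => ∑ j, c j • x j ω := by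
  have h : ∀ᵐ ω ∂μ, ∀ j, (((c j : ℤ) : ℝ) • x j : Lp ℝ p μ) ω = ((c j : ℤ) : ℝ) * x j ω :=
    ae_all_iff.2 fun j => by
      filter_upwards [Lp.coeFn_smul ((c j : ℤ) : ℝ) (x j)] with ω hω
      simpa using hω
  simp only [← Int.cast_smul_eq_zsmul ℝ]
  filter_upwards [Lp.coeFn_finsetSum Finset.univ fun j => ((c j : ℤ) : ℝ) • x j, h] with ω h1 h2
  rw [h1, Finset.sum_apply]
  exact Finset.sum_congr rfl fun j _ => by rw [h2, smul_eq_mul]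

theorem eLpNorm_sq {Ω : Type*} [MeasurableSpace Ω] {μ : Measure Ω} (p : ℝ≥0∞) (f : Ω → ℝ) :
    eLpNorm (fun ω => f ω ^ 2) (p / 2) μ = eLpNorm f p μ ^ 2 := by
  have h := eLpNorm_norm_rpow (μ := μ) (p := p / 2) f (two_pos : (0 : ℝ) < 2)
  have h2 : p / 2 * ENNReal.ofReal 2 = p := by
    simpa using ENNReal.div_mul_cancel (a := 2) (b := p) (by simp) (by simp)
  rw [h2] at h
  simpa using h

theorem le_njQuotient_Lp {Ω : Type*} [MeasurableSpace Ω] {μ : Measure Ω} {p : ℝ≥0∞}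
    [Fact (1 ≤ p)] (hp : 2 ≤ p) {n : ℕ} (hn : 0 < n) (x : Fin n → Lp ℝ p μ)
    (hx : 0 < ∑ j, ‖x j‖ ^ 2) : (n : ℝ) ^ (2 / p.toReal - 1) ≤ njQuotient x := by
  set T := Finset.univ.filter fun θ : Fin n → ℤˣ => ∀ j : Fin n, (j : ℕ) = 0 → θ j = 1 with hT
  have hq : 1 ≤ p / 2 := by
    rw [ENNReal.le_div_iff_mul_le (by simp) (by simp)]
    simpa using hp
  have hm : ∀ j, Measurable (x j) := fun j => (Lp.stronglyMeasurable (x j)).measurable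
  set S : (Fin n → ℤˣ) → Ω → ℝ := fun θ ω => ∑ j, (θ j : ℤ) • x j ω with hS
  have hSm : ∀ θ, Measurable (S θ) := fun θ =>
    Finset.measurable_sum _ fun j _ => by
      simp only [zsmul_eq_mul]
      exact (hm j).const_mul _
  have hSn : ∀ θ, eLpNorm (S θ) p μ = ‖∑ j, (θ j : ℤ) • x j‖ₑ := fun θ => by
    rw [Lp.enorm_def]
    exact (eLpNorm_congr_ae (Lp.coeFn_sum_zsmul x fun j => (θ j : ℤ))).symm
  have h1 : ∑ j, ‖x j‖ₑ ^ 2 ≤ (n : ℝ≥0∞) ^ (1 - 2 / p.toReal) *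
      eLpNorm (∑ j, fun ω => x j ω ^ 2) (p / 2) μ := by
    have := sum_eLpNorm_le_of_nonneg (μ := μ) hq (b := fun j ω => x j ω ^ 2)
      (fun j ω => sq_nonneg _) (fun j => (hm j).pow_const 2)
    simp only [eLpNorm_sq, ← Lp.enorm_def, ENNReal.toReal_div] at this
    simpa using this
  -- Triangle inequality in `L^(p/2)`, applied to the squares of the signed sums.
  have h2 : (2 : ℝ≥0∞) ^ (n - 1) * eLpNorm (∑ j, fun ω => x j ω ^ 2) (p / 2) μ
      ≤ ∑ θ ∈ T, ‖∑ j, (θ j : ℤ) • x j‖ₑ ^ 2 := by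
    have h3 := eLpNorm_sum_le (μ := μ) (p := p / 2) (s := T) (f := fun θ ω => S θ ω ^ 2)
      (fun θ _ => ((hSm θ).pow_const 2).aestronglyMeasurable) hq
    simp only [eLpNorm_sq, hSn] at h3
    refine le_trans (le_of_eq ?_) h3
    have h4 : (∑ θ ∈ T, fun ω => S θ ω ^ 2) = (2 : ℝ) ^ (n - 1) • ∑ j, fun ω => x j ω ^ 2 := by
      ext ω
      simpa [Finset.sum_apply, hT, hS] using sum_signs_sq hn fun j => x j ω
    rw [h4, eLpNorm_const_smul, enorm_pow]
    congr 2
    rw [← ofReal_norm]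
    simp
  have h5 : (2 : ℝ≥0∞) ^ (n - 1) * ∑ j, ‖x j‖ₑ ^ 2 ≤
      (n : ℝ≥0∞) ^ (1 - 2 / p.toReal) * ∑ θ ∈ T, ‖∑ j, (θ j : ℤ) • x j‖ₑ ^ 2 := by
    refine (mul_le_mul_right h1 _).trans ?_
    rw [mul_left_comm]
    exact mul_le_mul_right h2 _
  have hn' : (0 : ℝ) < n := Nat.cast_pos.2 hn
  have h6 : (2 : ℝ) ^ (n - 1) * ∑ j, ‖x j‖ ^ 2 ≤
      (n : ℝ) ^ (1 - 2 / p.toReal) * ∑ θ ∈ T, ‖∑ j, (θ j : ℤ) • x j‖ ^ 2 := by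
    rw [← ENNReal.ofReal_le_ofReal_iff (by positivity), ENNReal.ofReal_mul (by positivity),
      ENNReal.ofReal_mul (by positivity), ENNReal.ofReal_sum_of_nonneg (by intros; positivity),
      ENNReal.ofReal_sum_of_nonneg (by intros; positivity), ← ENNReal.ofReal_rpow_of_pos hn']
    simpa [ENNReal.ofReal_pow] using h5
  rw [njQuotient, le_div_iff₀ (by positivity)]
  calc (n : ℝ) ^ (2 / p.toReal - 1) * (2 ^ (n - 1) * ∑ j, ‖x j‖ ^ 2)
      ≤ (n : ℝ) ^ (2 / p.toReal - 1) *
        ((n : ℝ) ^ (1 - 2 / p.toReal) * ∑ θ ∈ T, ‖∑ j, (θ j : ℤ) • x j‖ ^ 2) := by gcongr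
    _ = _ := by
      rw [← mul_assoc, ← Real.rpow_add hn']
      simp [hT]

theorem exists_disjoint_Lp {Ω : Type*} [MeasurableSpace Ω] {μ : Measure Ω} {p : ℝ≥0∞}
    [Fact (1 ≤ p)] {n : ℕ} {v : Fin n → Lp ℝ p μ} (hv : LinearIndependent ℝ v) :
    ∃ x : Fin n → Lp ℝ p μ, (∀ j, ‖x j‖ = 1) ∧
      ∀ᵐ ω ∂μ, ∀ i j, i ≠ j → x i ω = 0 ∨ x j ω = 0 := by
  obtain ⟨A, hAm, hA0, hAd, hAv⟩ := exists_disjoint_sets_of_linearIndependent hv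
  -- The sets may have infinite measure, so their indicators need not lie in `L^p`; `g` does, and it
  -- vanishes nowhere on them.
  set g : Ω → ℝ := fun ω => ∑ j, ‖v j ω‖ with hg
  have hgL : MemLp g p μ := memLp_finsetSum _ fun j _ => (Lp.memLp (v j)).norm
  have hgA : ∀ i, ∀ ω ∈ A i, g ω ≠ 0 := by
    intro i ω hω h0
    refine hAv i ω hω (funext fun j => ?_)
    have := (Finset.sum_eq_zero_iff_of_nonneg fun k _ => norm_nonneg (v k ω)).1 h0 j
      (Finset.mem_univ j)
    simpa using this
  set y : Fin n → Lp ℝ p μ := fun i => (hgL.indicator (hAm i)).toLp _ with hy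
  have hyc : ∀ᵐ ω ∂μ, ∀ i, y i ω = (A i).indicator g ω :=
    ae_all_iff.2 fun i => (hgL.indicator (hAm i)).coeFn_toLp
  have hy0 : ∀ i, y i ≠ 0 := by
    intro i h0
    refine hA0 i ?_
    have h1 : ∀ᵐ ω ∂μ, ω ∉ A i := by
      filter_upwards [hyc, Lp.coeFn_zero ℝ p μ] with ω h2 h3 hω
      have h4 := h2 i
      rw [h0, h3, Set.indicator_of_mem hω] at h4
      exact hgA i ω hω h4.symm
    simpa [ae_iff] using h1
  refine ⟨fun i => ‖y i‖⁻¹ • y i, fun i => norm_smul_inv_norm (hy0 i), ?_⟩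
  have hs : ∀ᵐ ω ∂μ, ∀ i, (‖y i‖⁻¹ • y i : Lp ℝ p μ) ω = ‖y i‖⁻¹ * y i ω :=
    ae_all_iff.2 fun i => by
      filter_upwards [Lp.coeFn_smul ‖y i‖⁻¹ (y i)] with ω hω
      simpa using hω
  filter_upwards [hyc, hs] with ω h1 h2 i j hij
  rw [h2, h2, h1, h1]
  by_cases hi : ω ∈ A i
  · have hj : ω ∉ A j := Set.disjoint_left.1 (hAd hij) hi
    simp [hj]
  · simp [hi]

theorem njQuotient_le_of_disjoint_Lp {Ω : Type*} [MeasurableSpace Ω] {μ : Measure Ω} {p : ℝ≥0∞}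
    [Fact (1 ≤ p)] {n : ℕ} (hn : 0 < n) {x : Fin n → Lp ℝ p μ} (hx : ∀ j, ‖x j‖ = 1)
    (hd : ∀ᵐ ω ∂μ, ∀ i j, i ≠ j → x i ω = 0 ∨ x j ω = 0) :
    njQuotient x ≤ (n : ℝ) ^ (2 / p.toReal - 1) := by
  have hn' : (0 : ℝ) < n := Nat.cast_pos.2 hn
  have hm : ∀ j, Measurable (x j) := fun j => (Lp.stronglyMeasurable (x j)).measurable
  have key : ∀ θ : Fin n → ℤˣ, ‖∑ j, (θ j : ℤ) • x j‖ ^ 2 ≤ (n : ℝ) ^ (2 / p.toReal) := by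
    intro θ
    -- Cutting down to `D` turns almost everywhere disjointness into disjointness at every point.
    set D : Set Ω := {ω | ∀ i j, i ≠ j → x i ω = 0 ∨ x j ω = 0} with hD
    have hDm : MeasurableSet D := by
      simp only [hD, Set.ofPred_forall]
      refine MeasurableSet.iInter fun i => MeasurableSet.iInter fun j => MeasurableSet.iInter
        fun _ => ?_
      exact (hm i (measurableSet_singleton 0)).union (hm j (measurableSet_singleton 0))
    have hu : ∀ j, ‖((θ j : ℤ) : ℝ)‖ₑ = 1 := fun j => by
      rcases Int.units_eq_one_or (θ j) with h | h <;> simp [h]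
    have h1 : ‖∑ j, (θ j : ℤ) • x j‖ₑ ≤ (n : ℝ≥0∞) ^ (1 / p.toReal) := by
      have h2 := eLpNorm_sum_le_of_disjoint (μ := μ) (p := p) (Fact.out : 1 ≤ p)
        (f := fun j => D.indicator fun ω => ((θ j : ℤ) : ℝ) * x j ω)
        (fun j => ((hm j).const_mul _).indicator hDm) ?_ ?_
      · rw [Lp.enorm_def]
        refine le_trans (le_of_eq (eLpNorm_congr_ae ?_)) h2
        filter_upwards [Lp.coeFn_sum_zsmul x fun j => (θ j : ℤ), hd] with ω h3 h4
        have h5 : ω ∈ D := h4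
        rw [h3]
        simp [h5]
      · intro ω i j hij
        by_cases h : ω ∈ D
        · rcases h i j hij with h0 | h0 <;> simp [h0, Set.indicator]
        · simp [h]
      · intro j
        refine (eLpNorm_indicator_le _).trans (le_of_eq ?_)
        have h3 := eLpNorm_const_smul ((θ j : ℤ) : ℝ) (x j) p μ
        rw [hu, one_mul, ← Lp.enorm_def, ← ofReal_norm, hx, ENNReal.ofReal_one] at h3
        exact h3
    have h2 : ‖∑ j, (θ j : ℤ) • x j‖ ≤ (n : ℝ) ^ (1 / p.toReal) := by
      rw [← ENNReal.ofReal_le_ofReal_iff (by positivity), ofReal_norm,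
        ← ENNReal.ofReal_rpow_of_pos hn']
      simpa using h1
    calc ‖∑ j, (θ j : ℤ) • x j‖ ^ 2 ≤ ((n : ℝ) ^ (1 / p.toReal)) ^ 2 := by gcongr
      _ = (n : ℝ) ^ (2 / p.toReal) := by
        rw [← Real.rpow_natCast, ← Real.rpow_mul hn'.le]
        congr 1
        push_cast
        ring
  have hsum : ∑ j, ‖x j‖ ^ 2 = (n : ℝ) := by simp [hx]
  rw [njQuotient, hsum, div_le_iff₀ (by positivity), Real.rpow_sub_one hn'.ne']
  refine (Finset.sum_le_card_nsmul _ _ _ fun θ _ => key θ).trans (le_of_eq ?_)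
  rw [card_signs hn, nsmul_eq_mul]
  push_cast
  field_simp

theorem isGreatest_lowerNJBounds_Lp {Ω : Type*} [MeasurableSpace Ω] (μ : Measure Ω) {p : ℝ≥0∞}
    [Fact (1 ≤ p)] (hp : 2 ≤ p) {n : ℕ} (hn : 0 < n)
    (hrank : (n : Cardinal) ≤ Module.rank ℝ (Lp ℝ p μ)) :
    IsGreatest (lowerNJBounds n (Lp ℝ p μ)) ((n : ℝ) ^ ((2 / p).toReal - 1)) := by
  have hn' : (0 : ℝ) < n := Nat.cast_pos.2 hn
  rw [ENNReal.toReal_div, ENNReal.toReal_ofNat]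
  refine ⟨⟨by positivity, fun x hx => le_njQuotient_Lp hp hn x hx⟩, fun C hC => ?_⟩
  obtain ⟨v, hv⟩ := Module.le_rank_iff.1 hrank
  obtain ⟨x, hx, hd⟩ := exists_disjoint_Lp hv
  exact (hC.2 x (by simpa [hx] using hn)).trans (njQuotient_le_of_disjoint_Lp hn hx hd)

/-! ### Transfer to sequence spaces through counting measure -/

theorem lowerNJBounds_congr {X Y : Type*} [NormedAddCommGroup X] [NormedAddCommGroup Y]
    [NormedSpace ℝ X] [NormedSpace ℝ Y] (e : X ≃ₗᵢ[ℝ] Y) (n : ℕ) :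
    lowerNJBounds n X = lowerNJBounds n Y := by
  have hq : ∀ x : Fin n → X, njQuotient (fun j => e (x j)) = njQuotient x := by
    intro x
    have : ∀ θ : Fin n → ℤˣ, ‖∑ j, (θ j : ℤ) • e (x j)‖ = ‖∑ j, (θ j : ℤ) • x j‖ := by
      intro θ
      rw [← e.norm_map, map_sum]
      simp only [map_zsmul]
    simp only [njQuotient, this, e.norm_map]
  ext C
  refine and_congr_right fun _ => ⟨fun h y hy => ?_, fun h x hx => ?_⟩
  · have := h (fun j => e.symm (y j)) (by simpa using hy)
    rw [← hq] at this
    simpa using this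
  · rw [← hq]
    exact h _ (by simpa using hx)

theorem enorm_lp_eq_eLpNorm_count {ι : Type*} [MeasurableSpace ι] [DiscreteMeasurableSpace ι]
    {p : ℝ≥0∞} [Fact (1 ≤ p)] (f : lp (fun _ : ι => ℝ) p) :
    eLpNorm (f : ι → ℝ) p Measure.count = ‖f‖ₑ := by
  rcases eq_or_ne p ∞ with rfl | hp'
  · rw [eLpNorm_exponent_top, eLpNormEssSup_count]
    have hle : ∀ i, ‖f i‖ₑ ≤ ‖f‖ₑ := fun i =>
      enorm_le_iff_norm_le.2 (lp.norm_apply_le_norm ENNReal.top_ne_zero f i)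
    have hfin : (⨆ i, ‖f i‖ₑ) ≠ ∞ := ((iSup_le hle).trans_lt enorm_lt_top).ne
    refine le_antisymm (iSup_le hle) ?_
    rw [← ofReal_norm]
    refine ENNReal.ofReal_le_of_le_toReal (lp.norm_le_of_forall_le ENNReal.toReal_nonneg fun i => ?_)
    rw [← toReal_enorm]
    exact ENNReal.toReal_mono hfin (le_iSup (fun i => ‖f i‖ₑ) i)
  · have hp0 : p ≠ 0 := (zero_lt_one.trans_le (Fact.out : 1 ≤ p)).ne'
    have hr0 : 0 < p.toReal := ENNReal.toReal_pos hp0 hp'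
    rw [← (ENNReal.rpow_left_injective hr0.ne').eq_iff, rpow_eLpNorm_eq_lintegral hp0 hp',
      lintegral_count, ← ofReal_norm, ENNReal.ofReal_rpow_of_nonneg (norm_nonneg _) hr0.le,
      lp.norm_rpow_eq_tsum hr0, ENNReal.ofReal_tsum_of_nonneg (fun _ => by positivity)
        ((lp.memℓp f).summable hr0)]
    refine tsum_congr fun i => ?_
    rw [← ofReal_norm, ENNReal.ofReal_rpow_of_nonneg (norm_nonneg _) hr0.le]

theorem memℓp_of_memLp_count {ι : Type*} [MeasurableSpace ι] [MeasurableSingletonClass ι]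
    {p : ℝ≥0∞} [Fact (1 ≤ p)] {f : ι → ℝ} (hf : MemLp f p Measure.count) : Memℓp f p := by
  have h := hf.2
  rcases eq_or_ne p ∞ with rfl | hp'
  · rw [eLpNorm_exponent_top, eLpNormEssSup_count] at h
    refine memℓp_infty ⟨(⨆ i, ‖f i‖ₑ).toReal, ?_⟩
    rintro _ ⟨i, rfl⟩
    dsimp only
    rw [← toReal_enorm]
    exact ENNReal.toReal_mono h.ne (le_iSup (fun i => ‖f i‖ₑ) i)
  · have hp0 : p ≠ 0 := (zero_lt_one.trans_le (Fact.out : 1 ≤ p)).ne'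
    have hr0 : 0 < p.toReal := ENNReal.toReal_pos hp0 hp'
    have h1 : ∑' i, ‖f i‖ₑ ^ p.toReal ≠ ∞ := by
      rw [← lintegral_count, ← rpow_eLpNorm_eq_lintegral hp0 hp']
      exact (ENNReal.rpow_lt_top_of_nonneg hr0.le h.ne).ne
    refine memℓp_gen ?_
    convert! ENNReal.summable_toReal h1 using 2 with i
    rw [← ENNReal.toReal_rpow, toReal_enorm]

/-- The space `ℓᵖ(ι)` is `Lᵖ` of the counting measure. -/
noncomputable def lpEquivLpCount (ι : Type*) [MeasurableSpace ι] [DiscreteMeasurableSpace ι]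
    (p : ℝ≥0∞) [Fact (1 ≤ p)] :
    lp (fun _ : ι => ℝ) p ≃ₗᵢ[ℝ] Lp ℝ p (Measure.count : Measure ι) :=
  have hmem : ∀ f : lp (fun _ : ι => ℝ) p, MemLp (f : ι → ℝ) p (Measure.count : Measure ι) :=
    fun f => ⟨(Measurable.of_discrete (f := (f : ι → ℝ))).aestronglyMeasurable, by
      rw [enorm_lp_eq_eLpNorm_count]; exact enorm_lt_top⟩
  LinearIsometryEquiv.ofSurjective
    { toFun := fun f => (hmem f).toLp (f : ι → ℝ)
      map_add' := fun f g => by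
        rw [← MemLp.toLp_add]
        rfl
      map_smul' := fun c f => by
        rw [RingHom.id_apply, ← MemLp.toLp_const_smul]
        rfl
      norm_map' := fun f => by
        have h : ‖(hmem f).toLp (f : ι → ℝ)‖ₑ = ‖f‖ₑ := by
          rw [Lp.enorm_toLp, enorm_lp_eq_eLpNorm_count]
        simpa using congrArg ENNReal.toReal h }
    fun g => ⟨⟨fun i => g i, memℓp_of_memLp_count (Lp.memLp g)⟩, Lp.toLp_coeFn g (Lp.memLp g)⟩

theorem isGreatest_lowerNJBounds_lp (ι : Type*) {p : ℝ≥0∞} [Fact (1 ≤ p)] (hp : 2 ≤ p) {n : ℕ}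
    (hn : 0 < n) (hrank : (n : Cardinal) ≤ Module.rank ℝ (lp (fun _ : ι => ℝ) p)) :
    IsGreatest (lowerNJBounds n (lp (fun _ : ι => ℝ) p)) ((n : ℝ) ^ ((2 / p).toReal - 1)) := by
  -- With every set measurable, any index set, countable or not, is covered.
  let _ : MeasurableSpace ι := ⊤
  have e := lpEquivLpCount ι p
  rw [lowerNJBounds_congr e]
  rw [e.toLinearEquiv.rank_eq] at hrank
  exact isGreatest_lowerNJBounds_Lp _ hp hn hrank

theorem mainTheorem6 (n : ℕ) (hn : 2 ≤ n) (p : ℝ≥0∞) [Fact (1 ≤ p)] (hp : 2 ≤ p) :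
    (∀ (Ω : Type*) [MeasurableSpace Ω] (μ : MeasureTheory.Measure Ω),
      (n : Cardinal) ≤ Module.rank ℝ (MeasureTheory.Lp ℝ p μ) →
        IsGreatest (lowerNJBounds n (MeasureTheory.Lp ℝ p μ)) ((n : ℝ) ^ ((2 / p).toReal - 1)) ∧
        lowerNJConstant n (MeasureTheory.Lp ℝ p μ) = (n : ℝ) ^ ((2 / p).toReal - 1)) ∧
    (∀ (ι : Type*),
      (n : Cardinal) ≤ Module.rank ℝ (lp (fun _ : ι => ℝ) p) →
        IsGreatest (lowerNJBounds n (lp (fun _ : ι => ℝ) p)) ((n : ℝ) ^ ((2 / p).toReal - 1)) ∧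
        lowerNJConstant n (lp (fun _ : ι => ℝ) p) = (n : ℝ) ^ ((2 / p).toReal - 1)) := by
  have hn0 : 0 < n := by omega
  refine ⟨fun Ω _ μ hrank => ?_, fun ι hrank => ?_⟩
  · have h := isGreatest_lowerNJBounds_Lp μ hp hn0 hrank
    exact ⟨h, h.csSup_eq⟩
  · have h := isGreatest_lowerNJBounds_lp ι hp hn0 hrank
    exact ⟨h, h.csSup_eq⟩
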